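/- Let $D$ be a metric space that is uniformly discrete (there is $\delta>0$ with $d(x,y)\ge\delta$ for all $x\ne y$ in $D$) and has bounded geometry (for every $R>0$ the number of points in balls of radius $R$ is uniformly bounded). For a Hilbert space $H$, let $C^*_H(D)\subset\mathbb B(\ell^2(D)\otimes H)$ be the Roe algebra, i.e. the norm closure of the $*$-algebra of operators $T$ that are locally compact ($Tf$ and $fT$ are compact for every $f\in C_0(D)$, acting by multiplication) and have finite propagation (there is $R>0$ with $fTg=0$ whenever the supports of $f,g\in C_0(D)$ are at distance greater than $R$); $C^*_{\mathbb C}(D)$ is the (unital) uniform Roe algebra. Let $V:\mathbb C\to H$ be an isometry, let $V_D=\mathrm{id}\otimes V:\ell^2(D)\to\ell^2(D)\otimes H$, and let $i_D:C^*_{\mathbb C}(D)\to C^*_H(D)$ be the $*$-homomorphism $i_D(T)=V_DTV_D^*$. For $\alpha>0$ let $D(\alpha)$ be the graph with vertex set $D$ in which two distinct points $x,y$ are joined by an edge whenever $d(x,y)\le\alpha$. Suppose that for every $\alpha>0$ the graph $D(\alpha)$ has at least one finite connected component. Then $(i_D)_*([1])\ne 0$ in $K_0(C^*_H(D))$, where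 $[1]\in K_0(C^*_{\mathbb C}(D))$ is the class of the unit. -/

import Mathlib

open scoped Matrix ENNReal ZeroAtInfty InnerProductSpace

noncomputable section

/-! ### `K₀` of C⋆-algebras, through projections in matrix algebras -/

section UnitalKTheory

variable {B C : Type*} [Ring B] [StarRing B] [Ring C] [StarRing C]

/-- Murray–von Neumann equivalence of (square, possibly of different size) matrices over `B`:
`p = v v⋆` and `q = v⋆ v` for some rectangular matrix `v`. -/
def MurrayVonNeumann {m n : Type*} [Fintype m] [Fintype n]
    (p : Matrix m m B) (q : Matrix n n B) : Prop :=
  ∃ v : Matrix m n B, v * vᴴ = p ∧ vᴴ * v = q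

namespace MurrayVonNeumann

variable {l m n m' n' : Type*} [Fintype l] [Fintype m] [Fintype n] [Fintype m'] [Fintype n']

theorem refl {p : Matrix m m B} (hp : IsStarProjection p) : MurrayVonNeumann p p := by
  have h1 : pᴴ = p := hp.isSelfAdjoint
  have h2 : p * p = p := hp.isIdempotentElem
  exact ⟨p, by rw [h1, h2], by rw [h1, h2]⟩

theorem symm {p : Matrix m m B} {q : Matrix n n B} (h : MurrayVonNeumann p q) :
    MurrayVonNeumann q p := by
  obtain ⟨v, h1, h2⟩ := h
  exact ⟨vᴴ, by simpa using h2, by simpa using h1⟩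

theorem trans {p : Matrix l l B} {q : Matrix m m B} {r : Matrix n n B}
    (hp : p * p = p) (hr : r * r = r)
    (h : MurrayVonNeumann p q) (h' : MurrayVonNeumann q r) : MurrayVonNeumann p r := by
  obtain ⟨v, hv1, hv2⟩ := h
  obtain ⟨w, hw1, hw2⟩ := h'
  refine ⟨v * w, ?_, ?_⟩
  · calc v * w * (v * w)ᴴ = v * (w * wᴴ) * vᴴ := by
          simp only [Matrix.conjTranspose_mul, Matrix.mul_assoc]
      _ = (v * vᴴ) * (v * vᴴ) := by rw [hw1, ← hv2]; simp only [Matrix.mul_assoc]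
      _ = p := by rw [hv1, hp]
  · calc (v * w)ᴴ * (v * w) = wᴴ * (vᴴ * v) * w := by
          simp only [Matrix.conjTranspose_mul, Matrix.mul_assoc]
      _ = (wᴴ * w) * (wᴴ * w) := by rw [hv2, ← hw1]; simp only [Matrix.mul_assoc]
      _ = r := by rw [hw2, hr]

theorem reindex {p : Matrix m m B} (hp : IsStarProjection p) (e : m ≃ n) :
    MurrayVonNeumann p (Matrix.reindex e e p) := by
  have h1 : pᴴ = p := hp.isSelfAdjoint
  have h2 : p * p = p := hp.isIdempotentElem
  refine ⟨p.submatrix id e.symm, ?_, ?_⟩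
  · rw [Matrix.conjTranspose_submatrix, h1, Matrix.submatrix_mul_equiv, h2, Matrix.submatrix_id_id]
  · rw [Matrix.conjTranspose_submatrix, h1, ← Matrix.submatrix_mul _ _ _ _ _ Function.bijective_id,
      h2, Matrix.reindex_apply]

theorem fromBlocks {p : Matrix m m B} {q : Matrix n n B} {p' : Matrix m' m' B}
    {q' : Matrix n' n' B} (h : MurrayVonNeumann p q) (h' : MurrayVonNeumann p' q') :
    MurrayVonNeumann (Matrix.fromBlocks p 0 0 p') (Matrix.fromBlocks q 0 0 q') := by
  obtain ⟨v, hv1, hv2⟩ := h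
  obtain ⟨w, hw1, hw2⟩ := h'
  refine ⟨Matrix.fromBlocks v 0 0 w, ?_, ?_⟩
  · simp [Matrix.fromBlocks_conjTranspose, Matrix.fromBlocks_multiply, hv1, hw1]
  · simp [Matrix.fromBlocks_conjTranspose, Matrix.fromBlocks_multiply, hv2, hw2]

end MurrayVonNeumann

theorem IsStarProjection.matrixFromBlocks {m n : Type*} [Fintype m] [Fintype n]
    {p : Matrix m m B} {q : Matrix n n B} (hp : IsStarProjection p) (hq : IsStarProjection q) :
    IsStarProjection (Matrix.fromBlocks p 0 0 q) := by
  have h1 : pᴴ = p := hp.isSelfAdjoint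
  have h2 : p * p = p := hp.isIdempotentElem
  have h3 : qᴴ = q := hq.isSelfAdjoint
  have h4 : q * q = q := hq.isIdempotentElem
  constructor
  · change _ * _ = _
    simp [Matrix.fromBlocks_multiply, h2, h4]
  · change (_)ᴴ = _
    simp [Matrix.fromBlocks_conjTranspose, h1, h3]

theorem IsStarProjection.matrixReindex {m n : Type*} [Fintype m] [Fintype n]
    {p : Matrix m m B} (hp : IsStarProjection p) (e : m ≃ n) :
    IsStarProjection (Matrix.reindex e e p) := by
  have h1 : pᴴ = p := hp.isSelfAdjoint
  have h2 : p * p = p := hp.isIdempotentElem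
  constructor
  · change _ * _ = _
    rw [Matrix.reindex_apply, Matrix.submatrix_mul_equiv, h2]
  · change (_)ᴴ = _
    rw [Matrix.reindex_apply, Matrix.conjTranspose_submatrix, h1]

variable (B) in
/-- A projection (self-adjoint idempotent) in some matrix algebra `Mₙ(B)`. -/
structure MatrixProjection where
  size : ℕ
  mat : Matrix (Fin size) (Fin size) B
  isStarProjection : IsStarProjection mat

namespace MatrixProjection

instance setoid : Setoid (MatrixProjection B) where
  r p q := MurrayVonNeumann p.mat q.mat
  iseqv :=
    { refl := fun p => .refl p.isStarProjection
      symm := fun h => h.symm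
      trans := fun {p _ r} h h' =>
        h.trans p.isStarProjection.isIdempotentElem r.isStarProjection.isIdempotentElem h' }

/-- The block sum `diag(p, q)`. -/
def add (p q : MatrixProjection B) : MatrixProjection B where
  size := p.size + q.size
  mat := Matrix.reindex finSumFinEquiv finSumFinEquiv (Matrix.fromBlocks p.mat 0 0 q.mat)
  isStarProjection := (p.isStarProjection.matrixFromBlocks q.isStarProjection).matrixReindex _

/-- The projection of size `0`. -/
def zero : MatrixProjection B where
  size := 0
  mat := 0
  isStarProjection := .zero _

/-- The image of a projection under a unital ⋆-homomorphism, applied entrywise. -/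
def map [Algebra ℂ B] [Algebra ℂ C] (φ : B →⋆ₐ[ℂ] C) (p : MatrixProjection B) :
    MatrixProjection C where
  size := p.size
  mat := p.mat.map φ
  isStarProjection := by
    have h1 : p.matᴴ = p.mat := p.isStarProjection.isSelfAdjoint
    have h2 : p.mat * p.mat = p.mat := p.isStarProjection.isIdempotentElem
    constructor
    · change _ * _ = _
      rw [← Matrix.map_mul, h2]
    · change (_)ᴴ = _
      rw [← Matrix.conjTranspose_map φ (fun x => map_star φ x), h1]

theorem add_equiv_fromBlocks (p q : MatrixProjection B) :
    MurrayVonNeumann (Matrix.fromBlocks p.mat 0 0 q.mat) (p.add q).mat :=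
  .reindex (p.isStarProjection.matrixFromBlocks q.isStarProjection) _

theorem add_equiv_of_fromBlocks {p q r : MatrixProjection B}
    (h : MurrayVonNeumann (Matrix.fromBlocks p.mat 0 0 q.mat) r.mat) : p.add q ≈ r :=
  MurrayVonNeumann.trans (p.add q).isStarProjection.isIdempotentElem
    r.isStarProjection.isIdempotentElem (add_equiv_fromBlocks p q).symm h

theorem add_congr {p p' q q' : MatrixProjection B} (h : p ≈ p') (h' : q ≈ q') :
    p.add q ≈ p'.add q' := by
  refine add_equiv_of_fromBlocks (MurrayVonNeumann.trans ?_ ?_ (MurrayVonNeumann.fromBlocks h h')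
    (add_equiv_fromBlocks p' q'))
  · exact (p.isStarProjection.matrixFromBlocks q.isStarProjection).isIdempotentElem
  · exact (p'.add q').isStarProjection.isIdempotentElem

theorem map_congr [Algebra ℂ B] [Algebra ℂ C] (φ : B →⋆ₐ[ℂ] C) {p q : MatrixProjection B}
    (h : p ≈ q) : p.map φ ≈ q.map φ := by
  obtain ⟨v, h1, h2⟩ := h
  have e1 : v.map φ * (v.map φ)ᴴ = p.mat.map φ := by
    rw [← Matrix.conjTranspose_map φ (fun x => map_star φ x), ← Matrix.map_mul, h1]
  have e2 : (v.map φ)ᴴ * v.map φ = q.mat.map φ := by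
    rw [← Matrix.conjTranspose_map φ (fun x => map_star φ x), ← Matrix.map_mul, h2]
  exact ⟨v.map φ, e1, e2⟩

theorem add_comm_equiv (p q : MatrixProjection B) : p.add q ≈ q.add p := by
  refine add_equiv_of_fromBlocks (MurrayVonNeumann.trans ?_ ?_ ?_ (add_equiv_fromBlocks q p))
  · exact (p.isStarProjection.matrixFromBlocks q.isStarProjection).isIdempotentElem
  · exact (q.add p).isStarProjection.isIdempotentElem
  · have := MurrayVonNeumann.reindex (p.isStarProjection.matrixFromBlocks q.isStarProjection)
      (Equiv.sumComm _ _)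
    simpa [Matrix.reindex_apply] using this

theorem zero_add_equiv (p : MatrixProjection B) : zero.add p ≈ p := by
  refine add_equiv_of_fromBlocks ?_
  have : MurrayVonNeumann (Matrix.fromBlocks (zero : MatrixProjection B).mat 0 0 p.mat)
      (Matrix.reindex (Equiv.emptySum (Fin 0) _) (Equiv.emptySum (Fin 0) _)
        (Matrix.fromBlocks (zero : MatrixProjection B).mat 0 0 p.mat)) :=
    MurrayVonNeumann.reindex
      ((zero : MatrixProjection B).isStarProjection.matrixFromBlocks p.isStarProjection) _
  have e : Matrix.reindex (Equiv.emptySum (Fin 0) _) (Equiv.emptySum (Fin 0) _)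
        (Matrix.fromBlocks (zero : MatrixProjection B).mat 0 0 p.mat) = p.mat := by
    ext i j; rfl
  rwa [e] at this

theorem add_assoc_equiv (p q r : MatrixProjection B) : (p.add q).add r ≈ p.add (q.add r) := by
  have hp := p.isStarProjection
  have hq := q.isStarProjection
  have hr := r.isStarProjection
  refine add_equiv_of_fromBlocks ?_
  have h1 : MurrayVonNeumann (Matrix.fromBlocks (p.add q).mat 0 0 r.mat)
      (Matrix.fromBlocks (Matrix.fromBlocks p.mat 0 0 q.mat) 0 0 r.mat) :=
    (add_equiv_fromBlocks p q).symm.fromBlocks (.refl hr)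
  have h2 : MurrayVonNeumann (Matrix.fromBlocks (Matrix.fromBlocks p.mat 0 0 q.mat) 0 0 r.mat)
      (Matrix.fromBlocks p.mat 0 0 (Matrix.fromBlocks q.mat 0 0 r.mat)) := by
    have := MurrayVonNeumann.reindex ((hp.matrixFromBlocks hq).matrixFromBlocks hr)
      (Equiv.sumAssoc _ _ _)
    convert this using 1
    ext (i | i | i) (j | j | j) <;> rfl
  have h3 : MurrayVonNeumann (Matrix.fromBlocks p.mat 0 0 (Matrix.fromBlocks q.mat 0 0 r.mat))
      (Matrix.fromBlocks p.mat 0 0 (q.add r).mat) :=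
    (MurrayVonNeumann.refl hp).fromBlocks (add_equiv_fromBlocks q r)
  have h4 := add_equiv_fromBlocks p (q.add r)
  have i1 := ((p.add q).isStarProjection.matrixFromBlocks hr).isIdempotentElem
  have i3 := (hp.matrixFromBlocks (hq.matrixFromBlocks hr)).isIdempotentElem
  have i4 := (hp.matrixFromBlocks (q.add r).isStarProjection).isIdempotentElem
  have i5 := (p.add (q.add r)).isStarProjection.isIdempotentElem
  exact ((h1.trans i1 i3 h2).trans i1 i4 h3).trans i1 i5 h4

theorem map_add_equiv [Algebra ℂ B] [Algebra ℂ C] (φ : B →⋆ₐ[ℂ] C) (p q : MatrixProjection B) :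
    (p.add q).map φ ≈ (p.map φ).add (q.map φ) := by
  have e : (p.add q).map φ = (p.map φ).add (q.map φ) := by
    simp only [add, map, MatrixProjection.mk.injEq, heq_eq_eq, true_and]
    simp only [Matrix.reindex_apply, ← Matrix.submatrix_map, Matrix.fromBlocks_map]
    rw [Matrix.map_zero _ (map_zero φ), Matrix.map_zero _ (map_zero φ)]
    rfl
  rw [e]

end MatrixProjection

variable (B) in
/-- The abelian semigroup `V(B)` of Murray–von Neumann classes of projections in matrices over
`B`, with block sum as addition. -/
def ProjectionClass : Type _ := Quotient (MatrixProjection.setoid (B := B))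

namespace ProjectionClass

instance : Add (ProjectionClass B) where
  add := Quotient.map₂ MatrixProjection.add
    (fun _ _ h _ _ h' => MatrixProjection.add_congr h h')

instance : Zero (ProjectionClass B) where
  zero := Quotient.mk _ MatrixProjection.zero

instance : AddCommMonoid (ProjectionClass B) where
  add_assoc := by
    rintro ⟨p⟩ ⟨q⟩ ⟨r⟩
    exact Quotient.sound (MatrixProjection.add_assoc_equiv p q r)
  zero_add := by
    rintro ⟨p⟩
    exact Quotient.sound (MatrixProjection.zero_add_equiv p)
  add_zero := by
    rintro ⟨p⟩
    exact Quotient.sound (Setoid.trans (MatrixProjection.add_comm_equiv p _)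
      (MatrixProjection.zero_add_equiv p))
  add_comm := by
    rintro ⟨p⟩ ⟨q⟩
    exact Quotient.sound (MatrixProjection.add_comm_equiv p q)
  nsmul := nsmulRec

/-- The class of a matrix projection. -/
def mk (p : MatrixProjection B) : ProjectionClass B := Quotient.mk _ p

/-- The additive map induced by a unital ⋆-homomorphism. -/
def map [Algebra ℂ B] [Algebra ℂ C] (φ : B →⋆ₐ[ℂ] C) :
    ProjectionClass B →+ ProjectionClass C where
  toFun := Quotient.map (MatrixProjection.map φ) (fun _ _ h => MatrixProjection.map_congr φ h)
  map_zero' := by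
    refine Quotient.sound ?_
    refine ⟨0, ?_, ?_⟩ <;> ext i <;> exact i.elim0
  map_add' := by
    rintro ⟨p⟩ ⟨q⟩
    exact Quotient.sound (MatrixProjection.map_add_equiv φ p q)

end ProjectionClass

variable (B) in
/-- `K₀` of a unital C⋆-algebra: the Grothendieck group of `V(B)`. -/
abbrev UnitalK0 : Type _ := Algebra.GrothendieckAddGroup (ProjectionClass B)

/-- The map on `K₀` induced by a unital ⋆-homomorphism. -/
def UnitalK0.map [Algebra ℂ B] [Algebra ℂ C] (φ : B →⋆ₐ[ℂ] C) : UnitalK0 B →+ UnitalK0 C :=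
  Algebra.GrothendieckAddGroup.lift
    (Algebra.GrothendieckAddGroup.of.comp (ProjectionClass.map φ))

end UnitalKTheory

section KTheory

set_option linter.unusedSectionVars false

variable {A A' : Type*}
  [NonUnitalRing A] [StarRing A] [Module ℂ A] [SMulCommClass ℂ A A] [IsScalarTower ℂ A A]
  [StarModule ℂ A]
  [NonUnitalRing A'] [StarRing A'] [Module ℂ A'] [SMulCommClass ℂ A' A'] [IsScalarTower ℂ A' A']
  [StarModule ℂ A']

variable (A) in
/-- The augmentation `A⁺ → ℂ`, `(z, a) ↦ z`, of the unitization. -/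
def augmentation : Unitization ℂ A →⋆ₐ[ℂ] ℂ :=
  Unitization.starLift (0 : A →⋆ₙₐ[ℂ] ℂ)

variable (A) in
/-- `K₀(A) = ker (K₀(A⁺) → K₀(ℂ))`, for a C⋆-algebra `A` that need not have a unit. -/
def K0 : AddSubgroup (UnitalK0 (Unitization ℂ A)) :=
  (UnitalK0.map (augmentation A)).ker

theorem UnitalK0.map_of {B C : Type*} [Ring B] [StarRing B] [Ring C] [StarRing C]
    [Algebra ℂ B] [Algebra ℂ C] (φ : B →⋆ₐ[ℂ] C) (x : ProjectionClass B) :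
    UnitalK0.map φ (Algebra.GrothendieckAddGroup.of x) =
      Algebra.GrothendieckAddGroup.of (ProjectionClass.map φ x) :=
  DFunLike.congr_fun (Algebra.GrothendieckAddGroup.lift.symm_apply_apply
    (Algebra.GrothendieckAddGroup.of.comp (ProjectionClass.map φ))) x

theorem UnitalK0.map_comp {B C E : Type*} [Ring B] [StarRing B] [Ring C] [StarRing C]
    [Ring E] [StarRing E] [Algebra ℂ B] [Algebra ℂ C] [Algebra ℂ E]
    (ψ : C →⋆ₐ[ℂ] E) (φ : B →⋆ₐ[ℂ] C) :
    (UnitalK0.map ψ).comp (UnitalK0.map φ) = UnitalK0.map (ψ.comp φ) := by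
  apply Algebra.GrothendieckAddGroup.lift.symm.injective
  ext x
  change UnitalK0.map ψ (UnitalK0.map φ (Algebra.GrothendieckAddGroup.of x)) =
    UnitalK0.map (ψ.comp φ) (Algebra.GrothendieckAddGroup.of x)
  rw [UnitalK0.map_of, UnitalK0.map_of, UnitalK0.map_of]
  obtain ⟨p⟩ := x
  rfl

@[simp]
theorem augmentation_inr (a : A) : augmentation A (a : Unitization ℂ A) = 0 :=
  Unitization.starLift_symm_apply_apply (augmentation A) a ▸
    DFunLike.congr_fun (Unitization.starLift.symm_apply_apply (0 : A →⋆ₙₐ[ℂ] ℂ)) a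

theorem augmentation_comp_starMap (φ : A →⋆ₙₐ[ℂ] A') :
    (augmentation A').comp (Unitization.starMap φ) = augmentation A := by
  apply Unitization.starAlgHom_ext
  ext a
  change augmentation A' (Unitization.starMap φ (a : Unitization ℂ A)) = augmentation A a
  rw [Unitization.starMap_inr, augmentation_inr, augmentation_inr]

/-- The homomorphism `φ_* : K₀(A) → K₀(A')` induced by a ⋆-homomorphism `φ : A → A'`. -/
def K0.map (φ : A →⋆ₙₐ[ℂ] A') : K0 A →+ K0 A' :=
  ((UnitalK0.map (Unitization.starMap φ)).comp (K0 A).subtype).codRestrict (K0 A') (by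
    rintro ⟨x, hx⟩
    have h := DFunLike.congr_fun
      (UnitalK0.map_comp (augmentation A') (Unitization.starMap φ)) x
    rw [augmentation_comp_starMap] at h
    exact h.trans hx)

/-- A projection `p ∈ A`, as a projection in the `1 × 1` matrices over `A⁺`. -/
def MatrixProjection.ofMem (p : A) (hp : IsStarProjection p) :
    MatrixProjection (Unitization ℂ A) where
  size := 1
  mat := Matrix.diagonal fun _ => (p : Unitization ℂ A)
  isStarProjection := by
    have h1 : star p = p := hp.isSelfAdjoint
    have h2 : p * p = p := hp.isIdempotentElem
    constructor
    · change _ * _ = _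
      rw [Matrix.diagonal_mul_diagonal]
      simp only [← Unitization.inr_mul, h2]
    · change (_)ᴴ = _
      rw [Matrix.diagonal_conjTranspose]
      congr 1
      ext1 i
      rw [Pi.star_apply, ← Unitization.inr_star, h1]

/-- The class `[p] ∈ K₀(A)` of a projection `p ∈ A`. -/
def K0.ofProjection (p : A) (hp : IsStarProjection p) : K0 A :=
  ⟨Algebra.GrothendieckAddGroup.of (ProjectionClass.mk (.ofMem p hp)), by
    change UnitalK0.map (augmentation A) _ = 0
    rw [UnitalK0.map_of]
    have : ProjectionClass.map (augmentation A) (ProjectionClass.mk (.ofMem p hp)) = 0 := by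
      refine Quotient.sound ⟨0, ?_, ?_⟩
      · have : (Matrix.diagonal fun _ : Fin 1 => (p : Unitization ℂ A)).map (augmentation A) =
            0 := by
          rw [Matrix.diagonal_map (map_zero _)]
          simp only [augmentation_inr, Matrix.diagonal_zero]
        exact (Matrix.zero_mul _).trans this.symm
      · ext i
        exact i.elim0
    rw [this, map_zero]⟩

end KTheory

/-! ### Locally compact and finite propagation operators -/

section Operators

variable {X E : Type*} [MetricSpace X] [NormedAddCommGroup E] [InnerProductSpace ℂ E]
  [CompleteSpace E]

/-- `T` is locally compact with respect to the action `ψ` of `C₀(X)` if `T ψ(f)` and `ψ(f) T` are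
compact operators for all `f ∈ C₀(X)`. -/
def IsLocallyCompactOperator (ψ : C₀(X, ℂ) →⋆ₙₐ[ℂ] (E →L[ℂ] E)) (T : E →L[ℂ] E) : Prop :=
  ∀ f : C₀(X, ℂ), IsCompactOperator (T * ψ f) ∧ IsCompactOperator (ψ f * T)

/-- `T` has finite propagation with respect to the action `ψ` of `C₀(X)` if there is `R > 0` with
`ψ(f) T ψ(g) = 0` whenever the supports of `f` and `g` are at distance greater than `R`.
(Requiring `R < dist x y` pointwise or for the infimum of the distances amounts to the same, after
enlarging `R`.) -/
def HasFinitePropagation (ψ : C₀(X, ℂ) →⋆ₙₐ[ℂ] (E →L[ℂ] E)) (T : E →L[ℂ] E) : Prop :=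
  ∃ R : ℝ, 0 < R ∧ ∀ f g : C₀(X, ℂ),
    (∀ x ∈ tsupport f, ∀ y ∈ tsupport g, R < dist x y) → ψ f * T * ψ g = 0

theorem isCompactOperator_star {T : E →L[ℂ] E} (hT : IsCompactOperator T) :
    IsCompactOperator (star T : E →L[ℂ] E) := by
  have hK : IsCompactOperator (T * star T : E →L[ℂ] E) := hT.comp_clm (star T : E →L[ℂ] E)
  have hK' := ((isCompactOperator_iff_isCompact_closure_image_closedBall
    (T * star T : E →L[ℂ] E).toLinearMap one_pos).1 hK).totallyBounded.subset subset_closure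
  refine (isCompactOperator_iff_isCompact_closure_image_closedBall
    (star T : E →L[ℂ] E).toLinearMap one_pos).2 ?_
  refine TotallyBounded.isCompact_of_isClosed (TotallyBounded.closure ?_) isClosed_closure
  rw [Metric.totallyBounded_iff]
  intro ε hε
  obtain ⟨u, hu, hufin, ht⟩ := Set.exists_subset_image_finite_and.1
    (Metric.finite_approx_of_totallyBounded hK' (ε ^ 2 / 2) (by positivity))
  refine ⟨(star T : E →L[ℂ] E) '' u, hufin.image _, ?_⟩
  rintro _ ⟨x, hx, rfl⟩
  obtain ⟨_, ⟨y, hy, rfl⟩, hxy⟩ := Set.mem_iUnion₂.1 (ht ⟨x, hx, rfl⟩)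
  refine Set.mem_iUnion₂.2 ⟨_, ⟨y, hy, rfl⟩, ?_⟩
  have hx1 : ‖x‖ ≤ 1 := by simpa using hx
  have hy1 : ‖y‖ ≤ 1 := by simpa using hu hy
  have hd : ‖(T * star T : E →L[ℂ] E) (x - y)‖ < ε ^ 2 / 2 := by
    rw [map_sub, ← dist_eq_norm]
    exact hxy
  have hd2 : ‖x - y‖ ≤ 2 := (norm_sub_le x y).trans (by linarith)
  have key : ‖(star T : E →L[ℂ] E) (x - y)‖ ^ 2 ≤
      ‖(T * star T : E →L[ℂ] E) (x - y)‖ * ‖x - y‖ := by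
    have h1 : inner ℂ ((star T : E →L[ℂ] E) (x - y)) ((star T : E →L[ℂ] E) (x - y)) =
        inner ℂ ((T * star T : E →L[ℂ] E) (x - y)) (x - y) := by
      conv_lhs => rw [ContinuousLinearMap.star_eq_adjoint, ContinuousLinearMap.adjoint_inner_right]
      rfl
    have h2 := norm_inner_le_norm (𝕜 := ℂ) ((T * star T : E →L[ℂ] E) (x - y)) (x - y)
    rw [← h1, inner_self_eq_norm_sq_to_K] at h2
    simpa using h2
  rw [Metric.mem_ball, dist_eq_norm]
  change ‖(star T : E →L[ℂ] E) x - (star T : E →L[ℂ] E) y‖ < ε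
  rw [← map_sub]
  refine lt_of_pow_lt_pow_left₀ 2 hε.le ?_
  have hn := norm_nonneg ((T * star T : E →L[ℂ] E) (x - y))
  nlinarith

variable {ψ : C₀(X, ℂ) →⋆ₙₐ[ℂ] (E →L[ℂ] E)} {S T : E →L[ℂ] E}

namespace IsLocallyCompactOperator

theorem zero : IsLocallyCompactOperator ψ 0 := fun f => by
  constructor
  · rw [zero_mul]; exact isCompactOperator_zero
  · rw [mul_zero]; exact isCompactOperator_zero

theorem add (hS : IsLocallyCompactOperator ψ S) (hT : IsLocallyCompactOperator ψ T) :
    IsLocallyCompactOperator ψ (S + T) := fun f => by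
  constructor
  · rw [add_mul]; exact (hS f).1.add (hT f).1
  · rw [mul_add]; exact (hS f).2.add (hT f).2

theorem smul (c : ℂ) (hT : IsLocallyCompactOperator ψ T) :
    IsLocallyCompactOperator ψ (c • T) := fun f => by
  constructor
  · rw [smul_mul_assoc]; exact (hT f).1.smul c
  · rw [mul_smul_comm]; exact (hT f).2.smul c

theorem mul (hS : IsLocallyCompactOperator ψ S) (hT : IsLocallyCompactOperator ψ T) :
    IsLocallyCompactOperator ψ (S * T) := fun f => by
  constructor
  · rw [mul_assoc]; exact (hT f).1.clm_comp S
  · rw [← mul_assoc]; exact (hS f).2.comp_clm T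

theorem star (hT : IsLocallyCompactOperator ψ T) : IsLocallyCompactOperator ψ (star T) := fun f => by
  constructor
  · have := isCompactOperator_star (hT (Star.star f)).2
    rwa [star_mul, map_star, star_star] at this
  · have := isCompactOperator_star (hT (Star.star f)).1
    rwa [star_mul, map_star, star_star] at this

end IsLocallyCompactOperator

namespace HasFinitePropagation

theorem zero : HasFinitePropagation ψ 0 :=
  ⟨1, one_pos, fun f g _ => by rw [mul_zero, zero_mul]⟩

theorem add (hS : HasFinitePropagation ψ S) (hT : HasFinitePropagation ψ T) :
    HasFinitePropagation ψ (S + T) := by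
  obtain ⟨R, hR, h⟩ := hS
  obtain ⟨R', hR', h'⟩ := hT
  refine ⟨max R R', lt_max_of_lt_left hR, fun f g hfg => ?_⟩
  rw [mul_add, add_mul, h f g (fun x hx y hy => (le_max_left _ _).trans_lt (hfg x hx y hy)),
    h' f g (fun x hx y hy => (le_max_right _ _).trans_lt (hfg x hx y hy)), add_zero]

theorem smul (c : ℂ) (hT : HasFinitePropagation ψ T) : HasFinitePropagation ψ (c • T) := by
  obtain ⟨R, hR, h⟩ := hT
  refine ⟨R, hR, fun f g hfg => ?_⟩
  rw [mul_smul_comm, smul_mul_assoc, h f g hfg, smul_zero]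

theorem star (hT : HasFinitePropagation ψ T) : HasFinitePropagation ψ (star T) := by
  obtain ⟨R, hR, h⟩ := hT
  have key : ∀ f : C₀(X, ℂ), tsupport (Star.star f : C₀(X, ℂ)) = tsupport f := fun f => by
    simp only [tsupport]
    congr 1
    ext x
    simp
  refine ⟨R, hR, fun f g hfg => ?_⟩
  have := h (Star.star g) (Star.star f) (fun x hx y hy => by
    rw [key] at hx hy
    rw [dist_comm]
    exact hfg y hy x hx)
  have := congrArg (Star.star : (E →L[ℂ] E) → (E →L[ℂ] E)) this
  rwa [star_mul, star_mul, map_star, map_star, star_star, star_star, star_zero, ← mul_assoc] at this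

end HasFinitePropagation

end Operators

/-! ### The Roe algebras of a discrete metric space -/

section Roe

/-- `L²(D) ⊗ H = ℓ²(D, H)`, for the counting measure on `D`. -/
abbrev EllTwo (D H : Type*) [NormedAddCommGroup H] : Type _ := lp (fun _ : D => H) 2

variable {D : Type*} {H : Type*} [NormedAddCommGroup H] [InnerProductSpace ℂ H]

variable (D) in
/-- The isometry `V_D = id ⊗ V : ℓ²(D) → ℓ²(D) ⊗ H` given by an isometry `V : ℂ → H`, that is,
`V` applied pointwise. -/
def isometryTensor (V : ℂ →ₗᵢ[ℂ] H) : EllTwo D ℂ →L[ℂ] EllTwo D H :=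
  lp.mapCLM 2 (fun _ => V.toContinuousLinearMap) zero_le_one
    (fun _ => V.norm_toContinuousLinearMap_le)

@[simp]
theorem isometryTensor_apply (V : ℂ →ₗᵢ[ℂ] H) (ξ : EllTwo D ℂ) (x : D) :
    isometryTensor D V ξ x = V (ξ x) := rfl

theorem adjoint_isometryTensor_comp [CompleteSpace H] (V : ℂ →ₗᵢ[ℂ] H) :
    (isometryTensor D V).adjoint ∘L isometryTensor D V = 1 := by
  ext1 ξ
  refine ext_inner_left ℂ fun η => ?_
  rw [ContinuousLinearMap.comp_apply, ContinuousLinearMap.adjoint_inner_right, lp.inner_eq_tsum,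
    one_apply_eq_self, lp.inner_eq_tsum]
  simp only [isometryTensor_apply, LinearIsometry.inner_map_map]

variable (D) in
/-- Conjugation `T ↦ V_D T V_D⋆` on all bounded operators. -/
def conjugation [CompleteSpace H] (V : ℂ →ₗᵢ[ℂ] H) :
    (EllTwo D ℂ →L[ℂ] EllTwo D ℂ) →⋆ₙₐ[ℂ] (EllTwo D H →L[ℂ] EllTwo D H) where
  toFun T := isometryTensor D V ∘L T ∘L (isometryTensor D V).adjoint
  map_smul' c T := by ext; simp
  map_zero' := by ext; simp
  map_add' S T := by ext; simp
  map_mul' S T := by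
    ext1 ξ
    exact congrArg (fun η => isometryTensor D V (S η))
      (DFunLike.congr_fun (adjoint_isometryTensor_comp V)
        (T ((isometryTensor D V).adjoint ξ))).symm
  map_star' T := by
    rw [ContinuousLinearMap.star_eq_adjoint, ContinuousLinearMap.star_eq_adjoint,
      ContinuousLinearMap.adjoint_comp, ContinuousLinearMap.adjoint_comp,
      ContinuousLinearMap.adjoint_adjoint]
    rfl

theorem conjugation_apply [CompleteSpace H] (V : ℂ →ₗᵢ[ℂ] H) (T : EllTwo D ℂ →L[ℂ] EllTwo D ℂ) :
    conjugation D V T = isometryTensor D V ∘L T ∘L (isometryTensor D V).adjoint := rfl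

theorem continuous_conjugation [CompleteSpace H] (V : ℂ →ₗᵢ[ℂ] H) : Continuous (conjugation D V) := by
  change Continuous fun T : EllTwo D ℂ →L[ℂ] EllTwo D ℂ =>
    isometryTensor D V ∘L T ∘L (isometryTensor D V).adjoint
  fun_prop

section Topology

variable [TopologicalSpace D]

/-- Multiplication by `f ∈ C₀(D)` on `ℓ²(D, H)`. -/
def multiplication (f : C₀(D, ℂ)) : EllTwo D H →L[ℂ] EllTwo D H :=
  lp.mapCLM 2 (fun x => f x • ContinuousLinearMap.id ℂ H) (norm_nonneg f) (fun x => by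
    refine ContinuousLinearMap.opNorm_le_bound _ (norm_nonneg f) (fun ξ => ?_)
    simp only [_root_.smul_apply, ContinuousLinearMap.id_apply, norm_smul]
    gcongr
    rw [← ZeroAtInftyContinuousMap.norm_toBCF_eq_norm]
    exact f.toBCF.norm_coe_le_norm x)

theorem norm_multiplication_le (f : C₀(D, ℂ)) :
    ‖(multiplication f : EllTwo D H →L[ℂ] EllTwo D H)‖ ≤ ‖f‖ := by
  unfold multiplication
  exact lp.norm_mapCLM_le _ _ _ _

@[simp]
theorem multiplication_apply (f : C₀(D, ℂ)) (ξ : EllTwo D H) (x : D) :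
    multiplication f ξ x = f x • ξ x := rfl

variable (D H) in
/-- The standard action of `C₀(D)` on `ℓ²(D, H)` by multiplication. -/
def multiplicationRep [CompleteSpace H] :
    C₀(D, ℂ) →⋆ₙₐ[ℂ] (EllTwo D H →L[ℂ] EllTwo D H) where
  toFun := multiplication
  map_smul' c f := by ext ξ x; simp [mul_smul]
  map_zero' := by ext ξ x; simp
  map_add' f g := by ext ξ x; simp [add_smul]
  map_mul' f g := by ext ξ x; simp [mul_smul]
  map_star' f := by
    rw [ContinuousLinearMap.star_eq_adjoint, ContinuousLinearMap.eq_adjoint_iff]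
    intro ξ η
    rw [lp.inner_eq_tsum, lp.inner_eq_tsum]
    congr 1
    ext x
    simp [inner_smul_left, inner_smul_right]

@[simp]
theorem multiplicationRep_apply [CompleteSpace H] (f : C₀(D, ℂ)) (ξ : EllTwo D H) (x : D) :
    multiplicationRep D H f ξ x = f x • ξ x := rfl

theorem multiplicationRep_comp_isometryTensor [CompleteSpace H] (V : ℂ →ₗᵢ[ℂ] H) (f : C₀(D, ℂ)) :
    multiplicationRep D H f ∘L isometryTensor D V =
      isometryTensor D V ∘L multiplicationRep D ℂ f := by
  ext ξ x
  exact (V.map_smul (f x) (ξ x)).symm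

theorem adjoint_isometryTensor_comp_multiplicationRep [CompleteSpace H] (V : ℂ →ₗᵢ[ℂ] H) (f : C₀(D, ℂ)) :
    (isometryTensor D V).adjoint ∘L multiplicationRep D H f =
      multiplicationRep D ℂ f ∘L (isometryTensor D V).adjoint := by
  have h := congrArg ContinuousLinearMap.adjoint
    (multiplicationRep_comp_isometryTensor V (star f))
  rw [ContinuousLinearMap.adjoint_comp, ContinuousLinearMap.adjoint_comp,
    ← ContinuousLinearMap.star_eq_adjoint, ← ContinuousLinearMap.star_eq_adjoint,
    ← map_star, ← map_star, star_star] at h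
  exact h

/-- The indicator function of a point of a discrete space. -/
def pointIndicator [DiscreteTopology D] (z : D) : C₀(D, ℂ) where
  toFun := Set.indicator {z} 1
  continuous_toFun := continuous_of_discreteTopology
  zero_at_infty' := by
    refine tendsto_const_nhds.congr' ?_
    filter_upwards [(isCompact_singleton (x := z)).compl_mem_cocompact] with x hx
    exact (Set.indicator_of_notMem hx _).symm

end Topology

variable [MetricSpace D] [DiscreteTopology D] [CompleteSpace H]

theorem HasFinitePropagation.mul {S T : EllTwo D H →L[ℂ] EllTwo D H}
    (hS : HasFinitePropagation (multiplicationRep D H) S)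
    (hT : HasFinitePropagation (multiplicationRep D H) T) :
    HasFinitePropagation (multiplicationRep D H) (S * T) := by
  classical
  obtain ⟨R, hR, h⟩ := hS
  obtain ⟨R', hR', h'⟩ := hT
  refine ⟨R + R', add_pos hR hR', fun f g hfg => ?_⟩
  have hsupp : ∀ z y : D, y ∈ tsupport (pointIndicator z) → y = z := fun z y hy => by
    rw [tsupport, closure_discrete] at hy
    by_contra hne
    exact hy (Set.indicator_of_notMem (s := {z}) hne 1)
  have hself : ∀ z : D, pointIndicator z z = 1 := fun z =>
    Set.indicator_of_mem (s := {z}) rfl 1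
  ext1 ξ
  set η : EllTwo D H := T (multiplicationRep D H g ξ) with hη
  change (multiplicationRep D H f) (S η) = 0
  have hsum := lp.hasSum_single (p := 2) (by simp) η
  have hsum' := ((multiplicationRep D H f).comp S).hasSum hsum
  have hzero : ∀ z : D, ((multiplicationRep D H f).comp S) (lp.single 2 z (η z)) = 0 := by
    intro z
    by_cases hz : ∃ y ∈ tsupport g, dist z y ≤ R'
    · obtain ⟨y, hy, hzy⟩ := hz
      have hfz := h f (pointIndicator z) (fun x hx w hw => by
        rw [hsupp z w hw]
        have h1 := hfg x hx y hy
        have h2 := dist_triangle x z y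
        linarith)
      have hsingle : multiplicationRep D H (pointIndicator z) (lp.single 2 z (η z)) =
          lp.single 2 z (η z) := by
        ext x
        rw [multiplicationRep_apply]
        by_cases hx : x = z
        · subst hx
          rw [hself, one_smul]
        · rw [lp.single_apply_ne _ _ _ hx, smul_zero]
      have := DFunLike.congr_fun hfz (lp.single 2 z (η z))
      change multiplicationRep D H f (S (multiplicationRep D H (pointIndicator z) _)) = 0 at this
      rw [hsingle] at this
      exact this
    · push Not at hz
      have hzg := h' (pointIndicator z) g (fun x hx y hy => by
        rw [hsupp z x hx]
        exact hz y hy)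
      have hηz : η z = 0 := by
        have := DFunLike.congr_fun hzg ξ
        change multiplicationRep D H (pointIndicator z) η = 0 at this
        have := congrArg (fun ζ : EllTwo D H => ζ z) this
        simpa [hself] using this
      rw [hηz, lp.single_zero, map_zero]
  simp only [hzero] at hsum'
  exact hsum'.unique hasSum_zero

variable (D H) in
/-- The ⋆-algebra of locally compact operators of finite propagation on `ℓ²(D, H)`. -/
def algebraicRoeAlgebra : NonUnitalStarSubalgebra ℂ (EllTwo D H →L[ℂ] EllTwo D H) where
  carrier := {T | IsLocallyCompactOperator (multiplicationRep D H) T ∧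
    HasFinitePropagation (multiplicationRep D H) T}
  zero_mem' := ⟨.zero, .zero⟩
  add_mem' hS hT := ⟨hS.1.add hT.1, hS.2.add hT.2⟩
  mul_mem' hS hT := ⟨hS.1.mul hT.1, hS.2.mul hT.2⟩
  smul_mem' c _ hT := ⟨hT.1.smul c, hT.2.smul c⟩
  star_mem' hT := ⟨hT.1.star, hT.2.star⟩

variable (D H) in
/-- The Roe algebra `C⋆_H(D)`: the norm closure of the ⋆-algebra of locally compact operators of
finite propagation. For `H = ℂ` this is the uniform Roe algebra `C⋆_ℂ(D)`. -/
def RoeAlgebra : NonUnitalStarSubalgebra ℂ (EllTwo D H →L[ℂ] EllTwo D H) :=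
  (algebraicRoeAlgebra D H).topologicalClosure

theorem isCompactOperator_multiplicationRep (f : C₀(D, ℂ)) :
    IsCompactOperator (multiplicationRep D ℂ f) := by
  classical
  have hself : ∀ z : D, pointIndicator z z = 1 := fun z =>
    Set.indicator_of_mem (s := {z}) rfl 1
  have hne : ∀ z x : D, x ≠ z → pointIndicator z x = 0 := fun z x hx =>
    Set.indicator_of_notMem (s := {z}) hx 1
  have hpoint : ∀ z : D, IsCompactOperator (multiplicationRep D ℂ (pointIndicator z)) := by
    intro z
    let ev : EllTwo D ℂ →L[ℂ] ℂ := innerSL ℂ (lp.single 2 z (1 : ℂ) : EllTwo D ℂ)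
    have hev : IsCompactOperator ev := isCompactOperator_of_locallyCompactSpace_dom ev
    have hcomp := hev.clm_comp (lp.singleContinuousLinearMap ℂ (fun _ : D => ℂ) 2 z)
    have heq : ⇑(multiplicationRep D ℂ (pointIndicator z)) =
        ⇑(lp.singleContinuousLinearMap ℂ (fun _ : D => ℂ) 2 z) ∘ ⇑ev := by
      funext ξ
      refine lp.ext (funext fun x => ?_)
      have hz : ev ξ = ξ z := by
        simp [ev, lp.inner_single_left]
      rw [multiplicationRep_apply, Function.comp_apply, hz, lp.singleContinuousLinearMap_apply]
      by_cases hx : x = z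
      · subst hx
        rw [hself, one_smul, lp.single_apply_self]
      · rw [hne z x hx, zero_smul, lp.single_apply_ne _ _ _ hx]
    rw [heq]
    exact hcomp
  let K := {T : EllTwo D ℂ →L[ℂ] EllTwo D ℂ | IsCompactOperator T}
  have hclosed : IsClosed K := isClosed_setOfPred_isCompactOperator
  have hcont : Continuous (multiplicationRep D ℂ) :=
    AddMonoidHomClass.continuous_of_bound _ 1 (fun g => by
      rw [one_mul]
      exact norm_multiplication_le g)
  have hC : IsClosed (multiplicationRep D ℂ ⁻¹' K) := hclosed.preimage hcont
  change f ∈ multiplicationRep D ℂ ⁻¹' K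
  rw [← hC.closure_eq, Metric.mem_closure_iff]
  intro ε hε
  have hfin : {x : D | ε / 2 ≤ ‖f x‖}.Finite := by
    have h0 := (zero_at_infty f).norm
    rw [norm_zero] at h0
    have h1 := h0.eventually (gt_mem_nhds (half_pos hε))
    rw [Filter.cocompact_eq_cofinite, Filter.eventually_cofinite] at h1
    simpa using h1
  let g : C₀(D, ℂ) := ∑ z ∈ hfin.toFinset, f z • pointIndicator z
  have hgx : ∀ x, g x = if ε / 2 ≤ ‖f x‖ then f x else 0 := by
    intro x
    have h1 : g x = ∑ z ∈ hfin.toFinset, f z * pointIndicator z x := by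
      have := map_sum (⟨⟨fun h : C₀(D, ℂ) => h x, rfl⟩, fun _ _ => rfl⟩ : C₀(D, ℂ) →+ ℂ)
        (fun z => f z • pointIndicator z) hfin.toFinset
      exact this
    rw [h1]
    split_ifs with h
    · rw [Finset.sum_eq_single x (fun z _ hz => by rw [hne z x hz.symm, mul_zero])
        (fun hx => absurd (hfin.mem_toFinset.2 h) hx), hself, mul_one]
    · refine Finset.sum_eq_zero fun z hz => ?_
      have hzx : x ≠ z := fun e => h (e ▸ hfin.mem_toFinset.1 hz)
      rw [hne z x hzx, mul_zero]
  refine ⟨g, ?_, ?_⟩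
  · change IsCompactOperator (multiplicationRep D ℂ g)
    change multiplicationRep D ℂ g ∈ compactOperator (RingHom.id ℂ) (EllTwo D ℂ) (EllTwo D ℂ)
    rw [map_sum]
    refine Submodule.sum_mem _ fun z _ => ?_
    rw [map_smul]
    exact Submodule.smul_mem _ _ (hpoint z)
  · rw [dist_eq_norm, ← ZeroAtInftyContinuousMap.norm_toBCF_eq_norm]
    refine lt_of_le_of_lt ((BoundedContinuousFunction.norm_le (half_pos hε).le).2 fun x => ?_)
      (half_lt_self hε)
    change ‖f x - g x‖ ≤ ε / 2
    rw [hgx]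
    split_ifs with h
    · rw [sub_self, norm_zero]
      exact (half_pos hε).le
    · rw [sub_zero]
      exact (not_le.1 h).le

variable (D) in
theorem one_mem_uniformRoeAlgebra : (1 : EllTwo D ℂ →L[ℂ] EllTwo D ℂ) ∈ RoeAlgebra D ℂ := by
  refine NonUnitalStarSubalgebra.le_topologicalClosure _ ⟨fun f => ?_, 1, one_pos, fun f g hfg => ?_⟩
  · rw [one_mul, mul_one]
    exact ⟨isCompactOperator_multiplicationRep f, isCompactOperator_multiplicationRep f⟩
  · rw [mul_one]
    ext ξ x
    change f x • g x • ξ x = 0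
    by_cases hf : f x = 0
    · rw [hf, zero_smul]
    by_cases hg : g x = 0
    · rw [hg, zero_smul, smul_zero]
    have := hfg x (subset_tsupport _ hf) x (subset_tsupport _ hg)
    rw [dist_self] at this
    linarith

variable (D) in
/-- The unit of the uniform Roe algebra. -/
def uniformRoeUnit : RoeAlgebra D ℂ := ⟨1, one_mem_uniformRoeAlgebra D⟩

variable (D) in
theorem isStarProjection_uniformRoeUnit : IsStarProjection (uniformRoeUnit D) :=
  ⟨Subtype.ext (one_mul 1), Subtype.ext (star_one _)⟩

theorem conjugation_mem (V : ℂ →ₗᵢ[ℂ] H) {T : EllTwo D ℂ →L[ℂ] EllTwo D ℂ}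
    (hT : T ∈ RoeAlgebra D ℂ) : conjugation D V T ∈ RoeAlgebra D H := by
  refine map_mem_closure (continuous_conjugation V) hT ?_
  rintro T ⟨hc, R, hR, h⟩
  have hr : ∀ f : C₀(D, ℂ), conjugation D V T * multiplicationRep D H f =
      isometryTensor D V ∘L (T * multiplicationRep D ℂ f) ∘L (isometryTensor D V).adjoint := by
    intro f
    ext1 ξ
    exact congrArg (fun η => isometryTensor D V (T η))
      (DFunLike.congr_fun (adjoint_isometryTensor_comp_multiplicationRep V f) ξ)
  have hl : ∀ S : EllTwo D ℂ →L[ℂ] EllTwo D ℂ, ∀ f : C₀(D, ℂ),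
      multiplicationRep D H f * (isometryTensor D V ∘L S ∘L (isometryTensor D V).adjoint) =
      isometryTensor D V ∘L (multiplicationRep D ℂ f * S) ∘L (isometryTensor D V).adjoint := by
    intro S f
    ext1 ξ
    exact DFunLike.congr_fun (multiplicationRep_comp_isometryTensor V f)
      (S ((isometryTensor D V).adjoint ξ))
  refine ⟨fun f => ⟨?_, ?_⟩, R, hR, fun f g hfg => ?_⟩
  · rw [hr]
    exact ((hc f).1.comp_clm (isometryTensor D V).adjoint).clm_comp (isometryTensor D V)
  · rw [conjugation_apply, hl]
    exact ((hc f).2.comp_clm (isometryTensor D V).adjoint).clm_comp (isometryTensor D V)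
  · rw [mul_assoc, hr, hl, ← mul_assoc, h f g hfg]
    ext1 ξ
    exact map_zero (isometryTensor D V)

/-- The ⋆-homomorphism `i_D : C⋆_ℂ(D) → C⋆_H(D)`, `T ↦ V_D T V_D⋆`. -/
def roeInclusion (D : Type*) [MetricSpace D] [DiscreteTopology D] (V : ℂ →ₗᵢ[ℂ] H) :
    RoeAlgebra D ℂ →⋆ₙₐ[ℂ] RoeAlgebra D H :=
  NonUnitalStarAlgHom.codRestrict
    ((conjugation D V).comp (NonUnitalStarSubalgebraClass.subtype (RoeAlgebra D ℂ)))
    (RoeAlgebra D H) (fun T => conjugation_mem V T.2)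

end Roe

/-! ### Coarse geometry -/

/-- A metric space is uniformly discrete if distinct points have distance bounded below by a
positive constant. -/
class UniformlyDiscrete (D : Type*) [MetricSpace D] : Prop where
  exists_le_dist : ∃ δ : ℝ, 0 < δ ∧ ∀ x y : D, x ≠ y → δ ≤ dist x y

instance UniformlyDiscrete.discreteTopology (D : Type*) [MetricSpace D] [UniformlyDiscrete D] :
    DiscreteTopology D := by
  obtain ⟨δ, hδ, h⟩ := UniformlyDiscrete.exists_le_dist (D := D)
  exact DiscreteTopology.of_forall_le_dist hδ (fun x y hxy => h x y hxy)

/-- A discrete metric space has bounded geometry if, for each `R > 0`, the number of points in balls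
of radius `R` is uniformly bounded. -/
def BoundedGeometry (D : Type*) [MetricSpace D] : Prop :=
  ∀ R : ℝ, 0 < R → ∃ N : ℕ, ∀ x : D, (Metric.closedBall x R).encard ≤ N

/-- The graph `D(α)`: its vertices are the points of `D`, and two (distinct) points `x`, `y` are
joined by an edge whenever `d(x, y) ≤ α`. -/
def distanceGraph (D : Type*) [MetricSpace D] (α : ℝ) : SimpleGraph D where
  Adj x y := x ≠ y ∧ dist x y ≤ α
  symm := ⟨fun x y h => ⟨h.1.symm, by rw [dist_comm]; exact h.2⟩⟩
  loopless := ⟨fun x h => h.1 rfl⟩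

end

noncomputable section

/-! ### Stable equivalence of projections over a unital ⋆-ring -/

section StableEquivalence

variable {B : Type*} [Ring B] [StarRing B]

theorem exists_murrayVonNeumann_of_grothendieck_eq_zero (p : MatrixProjection B)
    (h : Algebra.GrothendieckAddGroup.of (ProjectionClass.mk p) = 0) :
    ∃ r : MatrixProjection B, MurrayVonNeumann (Matrix.fromBlocks p.mat 0 0 r.mat) r.mat := by
  rw [← map_zero Algebra.GrothendieckAddGroup.of] at h
  obtain ⟨⟨c, _⟩, hc⟩ :=
    -- Vanishing in the Grothendieck group means vanishing after adding some class `c`; `V(B)` need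
    -- not be cancellative, so `r` has to be kept.
    ((AddLocalization.addMonoidOf (⊤ : AddSubmonoid (ProjectionClass B))).eq_iff_exists).1 h
  obtain ⟨r⟩ := c
  refine ⟨r, ?_⟩
  have hc' : ProjectionClass.mk (p.add r) = ProjectionClass.mk r := by
    change ProjectionClass.mk r + ProjectionClass.mk p = ProjectionClass.mk r + 0 at hc
    rw [add_zero, add_comm] at hc
    exact hc
  have hr : p.add r ≈ r := Quotient.exact hc'
  exact (MatrixProjection.add_equiv_fromBlocks p r).trans
    (p.isStarProjection.matrixFromBlocks r.isStarProjection).isIdempotentElem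
    r.isStarProjection.isIdempotentElem hr

variable {m n : Type*} [Fintype m] [Fintype n] [DecidableEq n]

/-- If `p ⊕ r ∼ r`, then there is a co-isometry `W` whose kernel contains a copy of `p`. -/
theorem MurrayVonNeumann.exists_right_inverse {p : Matrix m m B} {r : Matrix n n B}
    (hp : IsStarProjection p) (hr : IsStarProjection r)
    (h : MurrayVonNeumann (Matrix.fromBlocks p 0 0 r) r) :
    ∃ (W S : Matrix n n B) (a : Matrix m n B) (t : Matrix n m B),
      W * S = 1 ∧ W * t = 0 ∧ a * t = p := by
  obtain ⟨v, hv1, hv2⟩ := h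
  have hq : Matrix.fromBlocks p 0 0 r * Matrix.fromBlocks p 0 0 r = Matrix.fromBlocks p 0 0 r :=
    (hp.matrixFromBlocks hr).isIdempotentElem
  have hqs : (Matrix.fromBlocks p 0 0 r)ᴴ = Matrix.fromBlocks p 0 0 r :=
    (hp.matrixFromBlocks hr).isSelfAdjoint
  have hr2 : r * r = r := hr.isIdempotentElem
  have hrs : rᴴ = r := hr.isSelfAdjoint
  -- Over a general ⋆-ring `v vᴴ = q` does not force `q v = v`, as there is no C⋆-identity;
  -- replacing `v` by `q v` secures the relation `u r = u`.
  obtain ⟨u, hu1, hu2⟩ : ∃ u : Matrix (m ⊕ n) n B, u * uᴴ = Matrix.fromBlocks p 0 0 r ∧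
      u * r = u := by
    refine ⟨Matrix.fromBlocks p 0 0 r * v, ?_, ?_⟩
    · rw [Matrix.conjTranspose_mul, hqs, Matrix.mul_assoc, ← Matrix.mul_assoc v, hv1, hq, hq]
    · rw [Matrix.mul_assoc, show v * r = Matrix.fromBlocks p 0 0 r * v by
        rw [← hv1, Matrix.mul_assoc, hv2], ← Matrix.mul_assoc, hq]
  rw [← Matrix.fromRows_toRows u] at hu1 hu2
  generalize u.toRows₁ = a at *
  generalize u.toRows₂ = b at *
  rw [Matrix.conjTranspose_fromRows_eq_fromCols_conjTranspose, Matrix.fromRows_mul_fromCols,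
    Matrix.fromBlocks_inj] at hu1
  rw [Matrix.fromRows_mul, Matrix.fromRows_inj.eq_iff] at hu2
  obtain ⟨h11, h12, h21, h22⟩ := hu1
  obtain ⟨ha, hb⟩ := hu2
  have ha' : r * aᴴ = aᴴ := by
    have := congrArg Matrix.conjTranspose ha
    rwa [Matrix.conjTranspose_mul, hrs] at this
  have hb' : r * bᴴ = bᴴ := by
    have := congrArg Matrix.conjTranspose hb
    rwa [Matrix.conjTranspose_mul, hrs] at this
  -- The rows `a`, `b` of `u` satisfy `a aᴴ = p`, `b bᴴ = r`, `b aᴴ = 0`. The summand `1 - r` raises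
  -- `b bᴴ = r` to `1`; the cross terms die because `b r = b`.
  refine ⟨b + (1 - r), bᴴ + (1 - r), a, aᴴ, ?_, ?_, h11⟩
  · simp only [Matrix.add_mul, Matrix.mul_add, Matrix.sub_mul, Matrix.mul_sub, Matrix.one_mul,
      Matrix.mul_one, h22, hb, hb', hr2]
    abel
  · simp only [Matrix.add_mul, Matrix.sub_mul, Matrix.one_mul, h21, ha', sub_self, add_zero]

end StableEquivalence

/-! ### Normalizing scalar parts in the unitization -/

section ScalarNormalization

variable {A : Type*} [NonUnitalRing A] [Module ℂ A] [SMulCommClass ℂ A A] [IsScalarTower ℂ A A]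
  {m n : Type*} [Fintype n] [DecidableEq n]

/-- The scalar parts of `W` and `S` are square complex matrices, so they are two-sided inverses of
each other. Hence the scalar part of `t`, killed by that of `W`, is zero, and multiplying `S` on the
right by the scalar part of `W`, and `W` on the left by that of `S`, gives the normalized pair. -/
theorem Unitization.exists_right_inverse_scalar_one {W S : Matrix n n (Unitization ℂ A)}
    {t : Matrix n m (Unitization ℂ A)} (hWS : W * S = 1) (hWt : W * t = 0) :
    t.map (Unitization.fstHom ℂ A) = 0 ∧ ∃ W' S' : Matrix n n (Unitization ℂ A),
      W' * S' = 1 ∧ W' * t = 0 ∧ S'.map (Unitization.fstHom ℂ A) = 1 := by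
  let φ := Unitization.fstHom ℂ A
  let ι := algebraMap ℂ (Unitization ℂ A)
  have h1 : W.map φ * S.map φ = 1 := by
    rw [← Matrix.map_mul, hWS, Matrix.map_one _ (map_zero φ) (map_one φ)]
  have h2 : S.map φ * W.map φ = 1 := mul_eq_one_comm.1 h1
  have h3 : W.map φ * t.map φ = 0 := by
    rw [← Matrix.map_mul, hWt, Matrix.map_zero _ (map_zero φ)]
  refine ⟨?_, (S.map φ).map ι * W, S * (W.map φ).map ι, ?_, ?_, ?_⟩
  · change t.map φ = 0
    rw [← Matrix.one_mul (t.map φ), ← h2, Matrix.mul_assoc, h3, Matrix.mul_zero]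
  · rw [Matrix.mul_assoc, ← Matrix.mul_assoc W, hWS, Matrix.one_mul, ← Matrix.map_mul, h2,
      Matrix.map_one _ (map_zero ι) (map_one ι)]
  · rw [Matrix.mul_assoc, hWt, Matrix.mul_zero]
  · change (S * (W.map φ).map ι).map φ = 1
    have h4 : ((W.map φ).map ι).map φ = W.map φ := by
      ext i j
      rfl
    rw [Matrix.map_mul, h4, h2]

end ScalarNormalization

/-! ### From a vanishing class in `K₀` to matrices of operators -/

section VanishingClass

variable {A A' : Type*}
  [NonUnitalRing A] [StarRing A] [Module ℂ A] [SMulCommClass ℂ A A] [IsScalarTower ℂ A A]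
  [StarModule ℂ A]
  [NonUnitalRing A'] [StarRing A'] [Module ℂ A'] [SMulCommClass ℂ A' A'] [IsScalarTower ℂ A' A']
  [StarModule ℂ A']

/-- All that is used of K-theory is recorded here. The conditions on scalar parts say that `S - 1`
and `t` have entries in `A'`; `W` and `a` are unrestricted, since later only their norms matter. -/
theorem K0.exists_right_inverse_of_map_ofProjection_eq_zero (φ : A →⋆ₙₐ[ℂ] A') (p : A)
    (hp : IsStarProjection p) (h : K0.map φ (K0.ofProjection p hp) = 0) :
    ∃ (n : ℕ) (W S : Matrix (Fin n) (Fin n) (Unitization ℂ A'))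
      (a : Matrix (Fin 1) (Fin n) (Unitization ℂ A'))
      (t : Matrix (Fin n) (Fin 1) (Unitization ℂ A')),
      W * S = 1 ∧ W * t = 0 ∧ a * t = Matrix.diagonal (fun _ => (φ p : Unitization ℂ A')) ∧
        S.map (Unitization.fstHom ℂ A') = 1 ∧ t.map (Unitization.fstHom ℂ A') = 0 := by
  let q := (MatrixProjection.ofMem p hp).map (Unitization.starMap φ)
  have hq : Algebra.GrothendieckAddGroup.of (ProjectionClass.mk q) = 0 := by
    have h1 := congrArg Subtype.val h
    change UnitalK0.map (Unitization.starMap φ)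
      (Algebra.GrothendieckAddGroup.of (ProjectionClass.mk (.ofMem p hp))) = 0 at h1
    rw [UnitalK0.map_of] at h1
    exact h1
  have hqmat : q.mat = Matrix.diagonal (fun _ : Fin 1 => (φ p : Unitization ℂ A')) := by
    change (Matrix.diagonal fun _ : Fin 1 => (p : Unitization ℂ A)).map
      (Unitization.starMap φ) = _
    rw [Matrix.diagonal_map (map_zero _)]
    simp only [Unitization.starMap_inr]
  obtain ⟨r, hr⟩ := exists_murrayVonNeumann_of_grothendieck_eq_zero q hq
  obtain ⟨W₀, S₀, a, t, hWS₀, hWt₀, hat⟩ :=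
    hr.exists_right_inverse q.isStarProjection r.isStarProjection
  obtain ⟨ht, W, S, hWS, hWt, hS⟩ := Unitization.exists_right_inverse_scalar_one hWS₀ hWt₀
  exact ⟨r.size, W, S, a, t, hWS, hWt, hat.trans hqmat, hS, ht⟩

/-- The same, in a representation of `A'` in a unital algebra. -/
theorem K0.exists_right_inverse_in_representation {C : Type*} [Ring C] [Algebra ℂ C]
    (π : A' →ₙₐ[ℂ] C) (φ : A →⋆ₙₐ[ℂ] A') (p : A)
    (hp : IsStarProjection p) (h : K0.map φ (K0.ofProjection p hp) = 0) :
    ∃ (n : ℕ) (W S : Matrix (Fin n) (Fin n) C) (a : Matrix (Fin 1) (Fin n) C)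
      (t : Matrix (Fin n) (Fin 1) C),
      W * S = 1 ∧ W * t = 0 ∧ a * t = Matrix.diagonal (fun _ => π (φ p)) ∧
        (∀ i j, (S - 1) i j ∈ Set.range π) ∧ ∀ i j, t i j ∈ Set.range π := by
  obtain ⟨n, W, S, a, t, hWS, hWt, hat, hS, ht⟩ :=
    K0.exists_right_inverse_of_map_ofProjection_eq_zero φ p hp h
  let ρ : Unitization ℂ A' →ₐ[ℂ] C := Unitization.lift π
  have hρ : ∀ x, ρ x = algebraMap ℂ C x.fst + π x.snd := fun x => rfl
  refine ⟨n, W.map ρ, S.map ρ, a.map ρ, t.map ρ, ?_, ?_, ?_, fun i j => ⟨(S i j).snd, ?_⟩,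
    fun i j => ⟨(t i j).snd, ?_⟩⟩
  · rw [← Matrix.map_mul, hWS, Matrix.map_one _ (map_zero ρ) (map_one ρ)]
  · rw [← Matrix.map_mul, hWt, Matrix.map_zero _ (map_zero ρ)]
  · rw [← Matrix.map_mul, hat, Matrix.diagonal_map (map_zero _)]
    simp only [hρ, Unitization.fst_inr, Unitization.snd_inr, map_zero, zero_add]
  · have h1 : (S i j).fst = (1 : Matrix _ _ ℂ) i j := congrFun (congrFun hS i) j
    rw [Matrix.sub_apply, Matrix.map_apply, hρ, h1]
    by_cases hij : i = j
    · subst hij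
      rw [Matrix.one_apply_eq, Matrix.one_apply_eq, map_one, add_sub_cancel_left]
    · rw [Matrix.one_apply_ne hij, Matrix.one_apply_ne hij, map_zero, zero_add, sub_zero]
  · have h1 : (t i j).fst = 0 := congrFun (congrFun ht i) j
    rw [Matrix.map_apply, hρ, h1, map_zero, zero_add]

end VanishingClass

/-! ### Matrices of operators acting on finite powers -/

section MatrixOperator

variable {E : Type*} [NormedAddCommGroup E] [NormedSpace ℂ E]
  {l m n : Type*} [Fintype l] [Fintype m] [Fintype n]

/-- The operator `Eⁿ → Eᵐ` given by an `m × n` matrix of operators on `E`. -/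
def matrixOperator (M : Matrix m n (E →L[ℂ] E)) : (n → E) →L[ℂ] (m → E) :=
  ContinuousLinearMap.pi fun i => ∑ j, M i j ∘L ContinuousLinearMap.proj j

omit [Fintype m] in
theorem matrixOperator_apply (M : Matrix m n (E →L[ℂ] E)) (x : n → E) (i : m) :
    matrixOperator M x i = ∑ j, M i j (x j) := by
  simp [matrixOperator]

omit [Fintype l] in
theorem matrixOperator_mul_apply (M : Matrix l m (E →L[ℂ] E)) (N : Matrix m n (E →L[ℂ] E))
    (x : n → E) : matrixOperator (M * N) x = matrixOperator M (matrixOperator N x) := by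
  ext i
  simp only [matrixOperator_apply, Matrix.mul_apply, sum_apply, map_sum,
    mul_apply_eq_comp]
  exact Finset.sum_comm

theorem matrixOperator_mul (M N : Matrix n n (E →L[ℂ] E)) :
    matrixOperator (M * N) = matrixOperator M * matrixOperator N :=
  ContinuousLinearMap.ext (matrixOperator_mul_apply M N)

theorem matrixOperator_one [DecidableEq n] :
    matrixOperator (1 : Matrix n n (E →L[ℂ] E)) = 1 := by
  ext x i
  rw [matrixOperator_apply, Finset.sum_eq_single i]
  · simp
  · intro j _ hj
    simp [Matrix.one_apply_ne hj.symm]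
  · simp

omit [Fintype m] in
theorem matrixOperator_add (M N : Matrix m n (E →L[ℂ] E)) :
    matrixOperator (M + N) = matrixOperator M + matrixOperator N := by
  ext x i
  simp [matrixOperator_apply, Finset.sum_add_distrib]

/-- Finite powers carry the sup norm, so it suffices to bound each row, a sum of `Fintype.card n`
terms. -/
theorem norm_matrixOperator_sub_apply_le {M N : Matrix m n (E →L[ℂ] E)} {η : ℝ} (hη : 0 ≤ η)
    (h : ∀ i j, ‖M i j - N i j‖ ≤ η) (x : n → E) :
    ‖matrixOperator M x - matrixOperator N x‖ ≤ Fintype.card n * η * ‖x‖ := by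
  refine (pi_norm_le_iff_of_nonneg (by positivity)).2 fun i => ?_
  rw [Pi.sub_apply, matrixOperator_apply, matrixOperator_apply, ← Finset.sum_sub_distrib]
  refine (norm_sum_le_of_le (f := fun j => M i j (x j) - N i j (x j)) (n := fun _ => η * ‖x‖)
    _ fun j _ => ?_).trans_eq ?_
  · rw [← sub_apply]
    exact ((M i j - N i j).le_opNorm (x j)).trans
      (mul_le_mul (h i j) (norm_le_pi_norm x j) (norm_nonneg _) hη)
  · rw [Finset.sum_const, nsmul_eq_mul, mul_assoc, Finset.card_univ]

theorem isCompactOperator_matrixOperator {M : Matrix m n (E →L[ℂ] E)}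
    (h : ∀ i j, IsCompactOperator (M i j)) : IsCompactOperator (matrixOperator M) := by
  classical
  have e : matrixOperator M = ∑ i, ∑ j, (ContinuousLinearMap.single ℂ (fun _ : m => E) i) ∘L
      (M i j ∘L ContinuousLinearMap.proj j) := by
    ext x i
    simp [matrixOperator_apply, Finset.sum_apply, Pi.single_apply]
  change matrixOperator M ∈ compactOperator (RingHom.id ℂ) (n → E) (m → E)
  rw [e]
  refine Submodule.sum_mem _ fun i _ => Submodule.sum_mem _ fun j _ => ?_
  have hj : IsCompactOperator (M i j ∘L ContinuousLinearMap.proj (φ := fun _ : n => E) j) :=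
    (h i j).comp_clm (ContinuousLinearMap.proj (R := ℂ) (φ := fun _ : n => E) j)
  exact hj.clm_comp (ContinuousLinearMap.single ℂ (fun _ : m => E) i)

end MatrixOperator

/-! ### Compact perturbations of the identity -/

section CompactPerturbation

variable {F : Type*} [NormedAddCommGroup F] [NormedSpace ℂ F] [CompleteSpace F]

/-- Fredholm alternative at `-1`: a nonzero number that is not an eigenvalue of a compact operator
lies in its resolvent set. -/
theorem IsCompactOperator.surjective_one_add_of_injective {K : F →L[ℂ] F}
    (hK : IsCompactOperator K) (h : ∀ x, x + K x = 0 → x = 0) (y : F) : ∃ x, x + K x = y := by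
  have hne : ¬ Module.End.HasEigenvalue (K : Module.End ℂ F) (-1) := by
    intro he
    obtain ⟨x, hx⟩ := he.exists_hasEigenvector
    refine hx.2 (h x ?_)
    have := hx.apply_eq_smul
    change K x = (-1 : ℂ) • x at this
    rw [this]
    simp
  have hres := (hK.hasEigenvalue_or_mem_resolventSet (μ := -1) (by simp)).resolve_left hne
  obtain ⟨u, hu⟩ := spectrum.mem_resolventSet_iff.1 hres
  have h1 : (u : F →L[ℂ] F) ((↑u⁻¹ : F →L[ℂ] F) y) = y := DFunLike.congr_fun u.mul_inv y
  rw [hu, Algebra.algebraMap_eq_smul_one, neg_one_smul, sub_apply, neg_apply,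
    one_apply_eq_self] at h1
  -- The unit `u` is `-1 - K`, whence the sign.
  refine ⟨-((↑u⁻¹ : F →L[ℂ] F) y), ?_⟩
  rwa [map_neg, ← sub_eq_add_neg]

/-- If `S` is left invertible, and `1 + K` is close to `S` and restricts to a compact perturbation
of the identity on the range of `Q`, then the range of `Q` is almost disjoint from the kernel of a
left inverse of `S`. -/
theorem norm_le_of_compact_perturbation {W S K Q : F →L[ℂ] F} (hWS : W * S = 1)
    (hQ : Q * Q = Q) (hQK : Q * K = K * Q) (hK : IsCompactOperator (Q * K : F →L[ℂ] F))
    {ε : ℝ} (hε0 : 0 ≤ ε) (hS : ∀ x, ‖S x - (x + K x)‖ ≤ ε * ‖x‖) (hε : ‖W‖ * ε ≤ 1 / 2)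
    {x x' : F} (hx : W x = 0) (hx' : Q x' = x') :
    ‖x'‖ ≤ (‖S‖ + ε) * (2 * (‖W‖ * ‖x' - x‖)) := by
  have hQQ : ∀ z, Q (Q z) = Q z := fun z => DFunLike.congr_fun hQ z
  have hQK' : ∀ z, Q (K z) = K (Q z) := fun z => DFunLike.congr_fun hQK z
  -- `W (1 + K)` differs from `W S = 1` by at most `‖W‖ ε ≤ 1/2` in norm, so it is bounded below by
  -- `1/2`.
  have hbound : ∀ z, ‖z‖ ≤ 2 * ‖W (z + K z)‖ := by
    intro z
    have h1 : W (S z) = z := DFunLike.congr_fun hWS z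
    have h2 : ‖W (S z - (z + K z))‖ ≤ 1 / 2 * ‖z‖ :=
      (W.le_opNorm _).trans ((mul_le_mul_of_nonneg_left (hS z) (norm_nonneg W)).trans
        (by rw [← mul_assoc]; exact mul_le_mul_of_nonneg_right hε (norm_nonneg z)))
    have h3 : z = W (S z - (z + K z)) + W (z + K z) := by
      rw [map_sub, h1, sub_add_cancel]
    have h4 := norm_add_le (W (S z - (z + K z))) (W (z + K z))
    rw [← h3] at h4
    linarith
  -- The alternative is applied to `1 + Q K` on all of `F` rather than on the range of `Q`. If `z +
  -- Q K z = 0`, applying `Q` gives `(1 + K) Q z = 0`, so `Q z = 0` by `hbound`; then `Q K z = K Q z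
  -- = 0` and `z = 0`.
  obtain ⟨z, hz⟩ := hK.surjective_one_add_of_injective (fun z hz => by
    change z + Q (K z) = 0 at hz
    have h1 : Q z + K (Q z) = 0 := by
      have := congrArg Q hz
      rwa [map_add, hQQ, hQK', map_zero] at this
    have h2 : Q z = 0 := by
      have := hbound (Q z)
      rw [h1, map_zero, norm_zero, mul_zero] at this
      exact norm_le_zero_iff.1 this
    rwa [hQK', h2, map_zero, add_zero] at hz) x'
  change z + Q (K z) = x' at hz
  have h1 : Q z + K (Q z) = x' := by
    rw [← hx', ← hz, map_add, hQQ, hQK']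
  have h2 : ‖Q z‖ ≤ 2 * (‖W‖ * ‖x' - x‖) := by
    refine (hbound (Q z)).trans ?_
    -- Since `W x = 0`, `W x'` may be replaced by `W (x' - x)`.
    rw [h1, ← sub_zero (W x'), ← hx, ← map_sub]
    exact mul_le_mul_of_nonneg_left (W.le_opNorm _) zero_le_two
  have h3 : ‖x'‖ ≤ (‖S‖ + ε) * ‖Q z‖ := by
    have h4 : x' = S (Q z) - (S (Q z) - (Q z + K (Q z))) := by
      rw [h1, sub_sub_cancel]
    have h5 := norm_sub_le (S (Q z)) (S (Q z) - (Q z + K (Q z)))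
    rw [← h4] at h5
    have h6 := S.le_opNorm (Q z)
    have h7 := hS (Q z)
    linarith
  exact h3.trans (mul_le_mul_of_nonneg_left h2 (add_nonneg (norm_nonneg S) hε0))

end CompactPerturbation

/-! ### Truncation to finite sets and finite propagation -/

section Truncation

variable {D : Type*} [MetricSpace D] [DiscreteTopology D]
  {H : Type*} [NormedAddCommGroup H] [InnerProductSpace ℂ H] [CompleteSpace H]

/-- The indicator function of a finite subset of a discrete space. -/
def finiteIndicator {C : Set D} (hC : C.Finite) : C₀(D, ℂ) where
  toFun := Set.indicator C 1
  continuous_toFun := continuous_of_discreteTopology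
  zero_at_infty' := by
    refine tendsto_const_nhds.congr' ?_
    filter_upwards [hC.isCompact.compl_mem_cocompact] with x hx
    exact (Set.indicator_of_notMem hx _).symm

theorem finiteIndicator_of_mem {C : Set D} (hC : C.Finite) {x : D} (hx : x ∈ C) :
    finiteIndicator hC x = 1 :=
  Set.indicator_of_mem hx 1

theorem finiteIndicator_of_notMem {C : Set D} (hC : C.Finite) {x : D} (hx : x ∉ C) :
    finiteIndicator hC x = 0 :=
  Set.indicator_of_notMem hx 1

variable (H) in
/-- The projection of `ℓ²(D, H)` onto `ℓ²(C, H)`. -/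
def truncation {C : Set D} (hC : C.Finite) : EllTwo D H →L[ℂ] EllTwo D H :=
  multiplicationRep D H (finiteIndicator hC)

theorem truncation_mul_self {C : Set D} (hC : C.Finite) :
    truncation H hC * truncation H hC = truncation H hC := by
  rw [truncation, ← map_mul]
  congr 1
  ext x
  rw [ZeroAtInftyContinuousMap.mul_apply]
  by_cases hx : x ∈ C
  · rw [finiteIndicator_of_mem hC hx, one_mul]
  · rw [finiteIndicator_of_notMem hC hx, zero_mul]

omit [DiscreteTopology D] in
theorem multiplicationRep_single [DecidableEq D] (f : C₀(D, ℂ)) (w : D) (η : H) :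
    multiplicationRep D H f (lp.single 2 w η) = f w • lp.single 2 w η := by
  ext x
  rw [multiplicationRep_apply, lp.coeFn_smul, Pi.smul_apply]
  by_cases hx : x = w
  · rw [hx]
  · rw [lp.single_apply_ne _ _ _ hx, smul_zero, smul_zero]

/-- `T` does not move supports by more than `R`. -/
def HasPropagationLE (R : ℝ) (T : EllTwo D H →L[ℂ] EllTwo D H) : Prop :=
  ∀ f g : C₀(D, ℂ), (∀ x ∈ tsupport f, ∀ y ∈ tsupport g, R < dist x y) →
    multiplicationRep D H f * T * multiplicationRep D H g = 0

omit [DiscreteTopology D] in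
theorem HasPropagationLE.mono {R R' : ℝ} {T : EllTwo D H →L[ℂ] EllTwo D H}
    (hT : HasPropagationLE R T) (h : R ≤ R') : HasPropagationLE R' T :=
  fun f g hfg => hT f g fun x hx y hy => h.trans_lt (hfg x hx y hy)

theorem HasPropagationLE.apply_single_apply [DecidableEq D] {R : ℝ}
    {T : EllTwo D H →L[ℂ] EllTwo D H} (hT : HasPropagationLE R T) {x w : D} (hxw : R < dist x w)
    (η : H) : T (lp.single 2 w η) x = 0 := by
  have hsupp : ∀ z y : D, y ∈ tsupport (pointIndicator z) → y = z := fun z y hy => by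
    rw [tsupport, closure_discrete] at hy
    by_contra hne
    exact hy (Set.indicator_of_notMem (s := {z}) hne 1)
  have hself : ∀ z : D, pointIndicator z z = 1 := fun z =>
    Set.indicator_of_mem (s := {z}) rfl 1
  have h := DFunLike.congr_fun (hT (pointIndicator x) (pointIndicator w) (fun x' hx' w' hw' => by
    rwa [hsupp x x' hx', hsupp w w' hw'])) (lp.single 2 w η)
  change multiplicationRep D H (pointIndicator x) (T (multiplicationRep D H (pointIndicator w)
    (lp.single 2 w η))) = 0 at h
  rw [multiplicationRep_single, hself, one_smul] at h
  have := congrArg (fun ζ : EllTwo D H => ζ x) h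
  simpa [hself] using this

/-- It suffices to test on vectors supported at one point `w`. The value of the image at `x`
vanishes if `dist x w > R`, and otherwise `hsep` gives the indicator of `C` the same value at `x`
and `w`. -/
theorem HasPropagationLE.truncation_mul {R : ℝ} {T : EllTwo D H →L[ℂ] EllTwo D H}
    (hT : HasPropagationLE R T) {C : Set D} (hC : C.Finite)
    (hsep : ∀ x w, dist x w ≤ R → (x ∈ C ↔ w ∈ C)) :
    truncation H hC * T = T * truncation H hC := by
  classical
  refine lp.ext_continuousLinearMap (by simp) fun w => ?_
  ext η x
  change truncation H hC (T (lp.single 2 w η)) x = T (truncation H hC (lp.single 2 w η)) x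
  rw [truncation, multiplicationRep_apply, multiplicationRep_single, map_smul, lp.coeFn_smul,
    Pi.smul_apply]
  rcases le_or_gt (dist x w) R with h | h
  · by_cases hx : x ∈ C
    · rw [finiteIndicator_of_mem hC hx, finiteIndicator_of_mem hC ((hsep x w h).1 hx)]
    · rw [finiteIndicator_of_notMem hC hx,
        finiteIndicator_of_notMem hC (mt (hsep x w h).2 hx)]
  · rw [hT.apply_single_apply h, smul_zero, smul_zero]

/-- The index set is finite, so a single `R` serves for all the approximants. -/
theorem exists_algebraic_approximation {ι : Type*} [Finite ι]
    {k : ι → EllTwo D H →L[ℂ] EllTwo D H} (hk : ∀ i, k i ∈ RoeAlgebra D H) {ε : ℝ} (hε : 0 < ε) :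
    ∃ (k' : ι → EllTwo D H →L[ℂ] EllTwo D H) (R : ℝ), 0 < R ∧ ∀ i, ‖k i - k' i‖ ≤ ε ∧
      IsLocallyCompactOperator (multiplicationRep D H) (k' i) ∧ HasPropagationLE R (k' i) := by
  have h : ∀ i, ∃ T ∈ (algebraicRoeAlgebra D H : Set (EllTwo D H →L[ℂ] EllTwo D H)),
      dist (k i) T < ε := fun i => Metric.mem_closure_iff.1 (hk i) ε hε
  choose k' hk' hd using h
  choose hc R hR hp using hk'
  obtain ⟨M, hM⟩ := Set.finite_range R |>.bddAbove
  refine ⟨k', max M 1, lt_max_of_lt_right one_pos, fun i => ⟨?_, hc i, ?_⟩⟩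
  · rw [← dist_eq_norm]
    exact (hd i).le
  · exact HasPropagationLE.mono (hp i) ((hM ⟨i, rfl⟩).trans (le_max_left _ _))

-- This supplies the separation hypothesis of `HasPropagationLE.truncation_mul`.
omit [DiscreteTopology D] in
theorem distanceGraph_mem_supp_iff {R : ℝ} (c : (distanceGraph D R).ConnectedComponent) (x w : D)
    (h : dist x w ≤ R) : x ∈ c.supp ↔ w ∈ c.supp := by
  by_cases hxw : x = w
  · rw [hxw]
  · have hadj : (distanceGraph D R).Adj x w := ⟨hxw, h⟩
    exact c.mem_supp_congr_adj hadj

/-! ### The contradiction on a finite component -/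

omit [MetricSpace D] [DiscreteTopology D] in
theorem conjugation_one_apply_isometryTensor (V : ℂ →ₗᵢ[ℂ] H) (ξ : EllTwo D ℂ) :
    conjugation D V 1 (isometryTensor D V ξ) = isometryTensor D V ξ :=
  congrArg (isometryTensor D V) (DFunLike.congr_fun (adjoint_isometryTensor_comp V) ξ)

/-- Both left-hand sides tend to `0` with `ε`. For `w`, `s`, `a` the norms of `W`, `S`, `a`, the
last one will bound `‖a‖ ‖t y‖`. -/
theorem exists_pos_perturbation_bound (w s a : ℝ) :
    ∃ ε : ℝ, 0 < ε ∧ w * ε < 1 / 2 ∧ a * ((s + ε) * (2 * (w * ε)) + ε) < 1 := by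
  have h1 : Filter.Tendsto (fun ε : ℝ => w * ε) (nhdsWithin 0 (Set.Ioi 0)) (nhds (w * 0)) :=
    (Continuous.tendsto (by fun_prop) 0).mono_left nhdsWithin_le_nhds
  have h2 : Filter.Tendsto (fun ε : ℝ => a * ((s + ε) * (2 * (w * ε)) + ε))
      (nhdsWithin 0 (Set.Ioi 0)) (nhds (a * ((s + 0) * (2 * (w * 0)) + 0))) :=
    (Continuous.tendsto (by fun_prop) 0).mono_left nhdsWithin_le_nhds
  have h3 := h1.eventually_lt_const (u := 1 / 2) (by norm_num)
  have h4 := h2.eventually_lt_const (u := 1) (by norm_num)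
  obtain ⟨ε, ⟨h5, h6⟩, h7⟩ := ((h3.and h4).and self_mem_nhdsWithin).exists
  exact ⟨ε, h7, h5, h6⟩

/-- A matrix `S` over the unitized Roe algebra with scalar part `1` and with a left inverse `W`
cannot miss, in the sense that `W t = 0`, a copy of the projection `V_D V_D⋆`. -/
theorem false_of_left_inverse (V : ℂ →ₗᵢ[ℂ] H)
    (hfin : ∀ α : ℝ, 0 < α →
      ∃ c : (distanceGraph D α).ConnectedComponent, c.supp.Finite)
    {n : Type*} [Fintype n] [DecidableEq n]
    {W S : Matrix n n (EllTwo D H →L[ℂ] EllTwo D H)}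
    {a : Matrix (Fin 1) n (EllTwo D H →L[ℂ] EllTwo D H)}
    {t : Matrix n (Fin 1) (EllTwo D H →L[ℂ] EllTwo D H)}
    (hWS : W * S = 1) (hWt : W * t = 0) (hat : a * t = Matrix.diagonal fun _ => conjugation D V 1)
    (hS : ∀ i j, (S - 1) i j ∈ RoeAlgebra D H) (ht : ∀ i j, t i j ∈ RoeAlgebra D H) : False := by
  classical
  -- The order of choices matters: `ε` depends only on the three norms, `R` on `ε`, and the
  -- component on `R`.
  obtain ⟨ε, hε0, hε1, hε2⟩ := exists_pos_perturbation_bound ‖matrixOperator W‖ ‖matrixOperator S‖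
    ‖matrixOperator a‖
  -- The entries of `S - 1` and `t` are approximated together to get a common `R`. The denominator
  -- absorbs the row sums, and its `+ 1` covers empty `n`.
  obtain ⟨k', R, hR, hk'⟩ := exists_algebraic_approximation
    (ι := (n × n) ⊕ n) (D := D) (H := H)
    (k := Sum.elim (fun ij => (S - 1) ij.1 ij.2) (fun i => t i 0))
    (by rintro (ij | i); exacts [hS _ _, ht _ _])
    (ε := ε / (Fintype.card n + 1)) (by positivity)
  obtain ⟨c, hc⟩ := hfin R hR
  obtain ⟨z, hz⟩ := c.nonempty_supp
  have hcomm := fun i => (hk' i).2.2.truncation_mul hc (distanceGraph_mem_supp_iff c)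
  let K : Matrix n n (EllTwo D H →L[ℂ] EllTwo D H) := Matrix.of fun i j => k' (.inl (i, j))
  let t' : Matrix n (Fin 1) (EllTwo D H →L[ℂ] EllTwo D H) := Matrix.of fun i _ => k' (.inr i)
  let Q : Matrix n n (EllTwo D H →L[ℂ] EllTwo D H) := Matrix.diagonal fun _ => truncation H hc
  -- A unit vector fixed both by `V_D V_D⋆` and by the truncation to the component.
  let v : EllTwo D H := isometryTensor D V (lp.single 2 z 1)
  let y : Fin 1 → EllTwo D H := fun _ => v
  have hv : ‖v‖ = 1 := by
    have : v = lp.single 2 z (V 1) := by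
      ext x
      rw [isometryTensor_apply]
      by_cases hx : x = z
      · subst hx
        rw [lp.single_apply_self, lp.single_apply_self]
      · rw [lp.single_apply_ne _ _ _ hx, lp.single_apply_ne _ _ _ hx, map_zero]
    rw [this, lp.norm_single (by simp), V.norm_map, norm_one]
  have hQv : truncation H hc v = v := by
    have := DFunLike.congr_fun (multiplicationRep_comp_isometryTensor V (finiteIndicator hc))
      (lp.single 2 z 1)
    refine this.trans ?_
    rw [ContinuousLinearMap.comp_apply, multiplicationRep_single, finiteIndicator_of_mem hc hz,
      one_smul]
  have hy : ‖y‖ = 1 := by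
    rw [pi_norm_const, hv]
  have hδ : ε / (Fintype.card n + 1) ≤ ε := div_le_self hε0.le (by simp)
  have hδ' : Fintype.card n * (ε / (Fintype.card n + 1)) ≤ ε := by
    rw [mul_div_assoc', div_le_iff₀ (by positivity)]
    nlinarith
  have hQapply : ∀ (u : n → EllTwo D H) (i : n), matrixOperator Q u i = truncation H hc (u i) := by
    intro u i
    change matrixOperator (Matrix.diagonal fun _ : n => truncation H hc) u i = _
    rw [matrixOperator_apply, Finset.sum_eq_single i]
    · rw [Matrix.diagonal_apply_eq]
    · intro j _ hj
      rw [Matrix.diagonal_apply_ne _ hj.symm, zero_apply]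
    · simp
  have hx : matrixOperator W (matrixOperator t y) = 0 := by
    rw [← matrixOperator_mul_apply, hWt]
    ext i
    simp [matrixOperator_apply]
  have hx' : matrixOperator Q (matrixOperator t' y) = matrixOperator t' y := by
    ext1 i
    rw [hQapply, matrixOperator_apply, Fin.sum_univ_one]
    change (truncation H hc * k' (.inr i)) v = k' (.inr i) v
    rw [hcomm]
    exact congrArg _ hQv
  have hxx : ‖matrixOperator t' y - matrixOperator t y‖ ≤ ε := by
    rw [norm_sub_rev]
    refine (norm_matrixOperator_sub_apply_le (η := ε / (Fintype.card n + 1)) (by positivity)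
      (fun i j => ?_) y).trans ?_
    · rw [Fin.fin_one_eq_zero j]
      exact (hk' (.inr i)).1
    · rw [hy, mul_one, Fintype.card_fin, Nat.cast_one, one_mul]
      exact hδ
  have hKQ : Q * K = K * Q := by
    ext1 i j
    rw [Matrix.diagonal_mul, Matrix.mul_diagonal]
    exact hcomm (.inl (i, j))
  have key := norm_le_of_compact_perturbation (W := matrixOperator W) (S := matrixOperator S)
    (K := matrixOperator K) (Q := matrixOperator Q)
    (by rw [← matrixOperator_mul, hWS, matrixOperator_one])
    (by rw [← matrixOperator_mul, Matrix.diagonal_mul_diagonal, truncation_mul_self])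
    (by rw [← matrixOperator_mul, ← matrixOperator_mul, hKQ])
    (by
      rw [← matrixOperator_mul]
      refine isCompactOperator_matrixOperator fun i j => ?_
      rw [Matrix.diagonal_mul]
      -- The truncation is multiplication by a function in `C₀(D)`, so local compactness applies to
      -- each entry.
      exact ((hk' (.inl (i, j))).2.1 _).2)
    hε0.le
    (fun u => by
      have h1 := norm_matrixOperator_sub_apply_le (M := S - 1) (N := K)
        (η := ε / (Fintype.card n + 1)) (by positivity) (fun i j => (hk' (.inl (i, j))).1) u
      have h2 : matrixOperator S u = matrixOperator (S - 1) u + u := by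
        have := congrArg (fun M => matrixOperator M u) (sub_add_cancel S 1)
        simp only [matrixOperator_add, matrixOperator_one] at this
        exact this.symm
      rw [h2, add_comm u, add_sub_add_right_eq_sub]
      exact h1.trans (mul_le_mul_of_nonneg_right hδ' (norm_nonneg u)))
    hε1.le hx hx'
  have hay : matrixOperator a (matrixOperator t y) = y := by
    rw [← matrixOperator_mul_apply, hat]
    ext1 i
    rw [matrixOperator_apply, Fin.sum_univ_one, Fin.fin_one_eq_zero i, Matrix.diagonal_apply_eq]
    exact conjugation_one_apply_isometryTensor V _
  -- `a t y = y` keeps `t y` away from `0`, whereas `key` and `hxx` make it small; `hε2` makes the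
  -- two incompatible.
  have h1 : 1 ≤ ‖matrixOperator a‖ * ‖matrixOperator t y‖ := by
    rw [← hy]
    nth_rewrite 1 [← hay]
    exact (matrixOperator a).le_opNorm _
  have h2 : ‖matrixOperator t y‖ ≤ ‖matrixOperator t' y‖ + ε := by
    have := norm_sub_le (matrixOperator t' y) (matrixOperator t' y - matrixOperator t y)
    rw [sub_sub_cancel] at this
    linarith
  have h3 : (‖matrixOperator S‖ + ε) * (2 * (‖matrixOperator W‖ * ‖matrixOperator t' y - matrixOperator t y‖)) ≤
      (‖matrixOperator S‖ + ε) * (2 * (‖matrixOperator W‖ * ε)) := by gcongr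
  have h4 : ‖matrixOperator a‖ * ‖matrixOperator t y‖ ≤ ‖matrixOperator a‖ * ((‖matrixOperator S‖ + ε) * (2 * (‖matrixOperator W‖ * ε)) + ε) :=
    mul_le_mul_of_nonneg_left (h2.trans (add_le_add_left (key.trans h3) ε))
      (norm_nonneg (matrixOperator a))
  linarith

end Truncation

end

/-! ### Non-vanishing of the class of the unit -/

theorem lemma3p5 {D : Type*} [MetricSpace D] [UniformlyDiscrete D] (hD : BoundedGeometry D)
    {H : Type*} [NormedAddCommGroup H] [InnerProductSpace ℂ H] [CompleteSpace H]
    (V : ℂ →ₗᵢ[ℂ] H)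
    (hfin : ∀ α : ℝ, 0 < α →
      ∃ c : (distanceGraph D α).ConnectedComponent, c.supp.Finite) :
    K0.map (roeInclusion D V)
      (K0.ofProjection (uniformRoeUnit D) (isStarProjection_uniformRoeUnit D)) ≠ 0 := by
  intro h
  -- The representation is the inclusion of the Roe algebra into the bounded operators, so lying in
  -- its range is membership in the Roe algebra.
  obtain ⟨n, W, S, a, t, hWS, hWt, hat, hS, ht⟩ := K0.exists_right_inverse_in_representation
    (NonUnitalStarSubalgebraClass.subtype (RoeAlgebra D H)).toNonUnitalAlgHom _ _ _ h
  refine false_of_left_inverse V hfin hWS hWt hat (fun i j => ?_) (fun i j => ?_)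
  · obtain ⟨x, hx⟩ := hS i j
    rw [← hx]
    exact x.2
  · obtain ⟨x, hx⟩ := ht i j
    rw [← hx]
    exact x.2
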